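/- Let $d\ge 3$ and let $X=(X_n)_{n\ge 0}$ be a random walk on $\mathbb Z^d$ started at the origin (that is, $X_0=0$ and the increments $X_{n+1}-X_n$ are independent and identically distributed). Assume that $X$ is symmetric ($X_1$ and $-X_1$ have the same law), transient (almost surely it visits the origin only finitely often), not supported on any subgroup of $\mathbb Z^d$ strictly smaller than $\mathbb Z^d$, and has finite second moments ($\mathbf E|X_1|^2<\infty$). For $B\subseteq\mathbb Z^d$ let $$\mu^X_n(B)=\sum_{j=0}^n \mathbf 1_B(X_j)$$ be the occupation measure of $X$ up to time $n$, and let $G(x)=\sum_{k=0}^\infty \mathbf P(X_k=x)$ be the Green's function. Let $A\subseteq\mathbb Z^d$ be a non-empty finite set, and let $\Lambda_A$ be the largest eigenvalue of the $|A|\times|A|$ matrix $G_A(x,y)=G(x-y)$, $x,y\in A$. Then $$\lim_{n\to\infty}\ \sup_{x\in\mathbb Z^d}\frac{\mu^X_n(x+A)}{\log n}=-\frac{1}{\log(1-1/\Lambda_A)}\qquad\text{almost surely}$$ and $$\lim_{n\to\infty}\ \sup_{0\le m\le n}\frac{\mu^X_n(X_m+A)}{\log n}=-\frac{1}{\log(1-1/\Lambda_A)}\qquad\text{almost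 surely.}$$ -/

import Mathlib

open MeasureTheory ProbabilityTheory Filter Topology
open scoped Pointwise

namespace LatticeWalk

noncomputable section

variable {d : ℕ} {Ω : Type*} [MeasurableSpace Ω]

/-- `X` is a random walk on `ℤ^d` started at the origin: its increments
`X (n + 1) - X n` are independent and all distributed as the first one. -/
structure IsRandomWalk (P : Measure Ω) (X : ℕ → Ω → (Fin d → ℤ)) : Prop where
  measurable : ∀ n, Measurable (X n)
  start : ∀ᵐ ω ∂P, X 0 ω = 0
  indep : iIndepFun (fun n ω => X (n + 1) ω - X n ω) P
  identDistrib : ∀ n,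
    IdentDistrib (fun ω => X (n + 1) ω - X n ω) (fun ω => X 1 ω - X 0 ω) P P

/-- The one-step law is invariant under `x ↦ -x`. -/
def IsSymmetricWalk (P : Measure Ω) (X : ℕ → Ω → (Fin d → ℤ)) : Prop :=
  IdentDistrib (X 1) (fun ω => -X 1 ω) P P

/-- Almost surely the origin is visited only finitely often. -/
def IsTransient (P : Measure Ω) (X : ℕ → Ω → (Fin d → ℤ)) : Prop :=
  ∀ᵐ ω ∂P, {n : ℕ | X n ω = 0}.Finite

/-- The walk is not supported on any subgroup strictly smaller than `ℤ^d`. -/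
def NotSupportedOnProperSubgroup (P : Measure Ω) (X : ℕ → Ω → (Fin d → ℤ)) : Prop :=
  ∀ H : AddSubgroup (Fin d → ℤ), (∀ᵐ ω ∂P, ∀ n, X n ω ∈ H) → H = ⊤

/-- Each coordinate of `X 1` is square integrable. -/
def HasFiniteSecondMoments (P : Measure Ω) (X : ℕ → Ω → (Fin d → ℤ)) : Prop :=
  ∀ i : Fin d, Integrable (fun ω => ((X 1 ω i : ℤ) : ℝ) ^ 2) P

/-- The occupation measure: the number of times `0 ≤ j ≤ n` with `X j ∈ A`. -/
def occupation (X : ℕ → Ω → (Fin d → ℤ)) (n : ℕ) (A : Set (Fin d → ℤ)) (ω : Ω) : ℝ :=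
  ∑ j ∈ Finset.range (n + 1), A.indicator (fun _ => (1 : ℝ)) (X j ω)

/-- The Green's function `G(x) = ∑ₖ P(Xₖ = x)`. -/
def green (P : Measure Ω) (X : ℕ → Ω → (Fin d → ℤ)) (x : Fin d → ℤ) : ℝ :=
  ∑' k : ℕ, P.real {ω | X k ω = x}

/-- The matrix `G(x - y)`, `x, y ∈ A`. -/
def greenMatrix (P : Measure Ω) (X : ℕ → Ω → (Fin d → ℤ)) (A : Finset (Fin d → ℤ)) :
    Matrix A A ℝ :=
  Matrix.of fun x y => green P X (x.1 - y.1)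

/-- The largest eigenvalue of a real square matrix. The set of real eigenvalues is always finite,
and for a symmetric matrix of positive size it is non-empty, so the supremum is a maximum. -/
def largestEigenvalue {ι : Type*} [Fintype ι] [DecidableEq ι] (M : Matrix ι ι ℝ) : ℝ :=
  sSup {l : ℝ | Module.End.HasEigenvalue (Matrix.toLin' M) l}

end

end LatticeWalk

namespace LatticeWalk

/-! ### Perron eigenvector of a positive symmetric matrix. -/

section Perron

open Matrix

variable {ι : Type*} [Fintype ι]

/-! Let `Λ` be the largest eigenvalue of `G_A` and `v > 0` its Perron eigenvector. The potential
`h(x) = ∑ y ∈ A, G(x - y) v y` equals `Λ v` on `A`. It is harmonic off `A`, while averaging it over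
one step from a point of `A` gives `h - v = (1 - 1/Λ) h`. So each visit to `A` multiplies `h` by `ρ
= 1 - 1/Λ`, and `k + 1` visits have probability of order `ρ ^ k`. `visitProb_le` and `le_visitProb`
prove this by induction on time with potentials truncated at time `n`. In the lower bound, any ratio
`r < ρ` is attained within a time linear in `k`.

Upper bound: a translate of `A` is first entered at some time `m ≤ n`, and the later visits are
those of a fresh walk started in `A`. More than `b log m` of them has probability of order `m ^ (b
log ρ)`, summable when `b > -1 / log ρ`, so Borel–Cantelli applies over `m`.

Lower bound: about `t ^ k` independent blocks of length linear in `k`, with `t > 1 / ρ`, almost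
surely contain one with `k + 1` visits once `k` is large. They fit into time `n` with `k` close to
`c log n` if `t < exp (1 / c)`. The set found is `X m + A`, so both suprema have the same limit. -/

lemma exists_isMaxOn_dotProduct_mulVec [Nonempty ι] [DecidableEq ι] (M : Matrix ι ι ℝ) :
    ∃ w : ι → ℝ, w ⬝ᵥ w = 1 ∧ ∀ x : ι → ℝ, x ⬝ᵥ M *ᵥ x ≤ (w ⬝ᵥ M *ᵥ w) * (x ⬝ᵥ x) := by
  have hcont : Continuous fun w : ι → ℝ => w ⬝ᵥ w := by unfold dotProduct; fun_prop
  have hcont' : Continuous fun w : ι → ℝ => w ⬝ᵥ M *ᵥ w := by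
    unfold mulVec dotProduct; fun_prop
  have hsub : {w : ι → ℝ | w ⬝ᵥ w = 1} ⊆ Set.pi Set.univ fun _ => Set.Icc (-1 : ℝ) 1 := by
    intro w hw i _
    have h1 : w i * w i ≤ w ⬝ᵥ w :=
      Finset.single_le_sum (f := fun i => w i * w i) (fun j _ => mul_self_nonneg _)
        (Finset.mem_univ i)
    rw [Set.mem_ofPred_eq] at hw
    constructor <;> nlinarith
  have hK : IsCompact {w : ι → ℝ | w ⬝ᵥ w = 1} :=
    (isCompact_univ_pi fun _ => isCompact_Icc).of_isClosed_subset
      (isClosed_eq hcont continuous_const) hsub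
  have hne : {w : ι → ℝ | w ⬝ᵥ w = 1}.Nonempty :=
    ⟨Pi.single (Classical.arbitrary ι) 1, by simp⟩
  obtain ⟨w, hw, hmax⟩ := hK.exists_isMaxOn hne hcont'.continuousOn
  refine ⟨w, hw, fun x => ?_⟩
  rcases eq_or_ne x 0 with rfl | hx
  · simp
  have hpos : 0 < x ⬝ᵥ x := by
    have := dotProduct_star_self_pos_iff.2 hx
    simpa using this
  set r := Real.sqrt (x ⬝ᵥ x) with hr
  have hr0 : 0 < r := Real.sqrt_pos.2 hpos
  have hrr : r * r = x ⬝ᵥ x := Real.mul_self_sqrt hpos.le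
  have hy : (r⁻¹ • x) ⬝ᵥ (r⁻¹ • x) = 1 := by
    rw [smul_dotProduct, dotProduct_smul, ← hrr, smul_eq_mul, smul_eq_mul]
    field_simp
  have h2 : (r⁻¹ • x) ⬝ᵥ M *ᵥ (r⁻¹ • x) ≤ w ⬝ᵥ M *ᵥ w := hmax hy
  rw [mulVec_smul, smul_dotProduct, dotProduct_smul, smul_eq_mul, smul_eq_mul] at h2
  rw [← hrr]
  calc x ⬝ᵥ M *ᵥ x = (r⁻¹ * (r⁻¹ * (x ⬝ᵥ M *ᵥ x))) * (r * r) := by field_simp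
    _ ≤ _ := by gcongr

/-- A symmetric matrix with positive entries has a positive eigenvector for its largest
eigenvalue. -/
theorem exists_pos_eigenvector [Nonempty ι] [DecidableEq ι] {M : Matrix ι ι ℝ}
    (hsymm : M.IsSymm) (hpos : ∀ i j, 0 < M i j) :
    ∃ v : ι → ℝ, (∀ i, 0 < v i) ∧ M *ᵥ v = largestEigenvalue M • v := by
  obtain ⟨w, hw, hmax⟩ := exists_isMaxOn_dotProduct_mulVec M
  set l := w ⬝ᵥ M *ᵥ w with hl
  set u : ι → ℝ := fun i => |w i| with hu
  have huu : u ⬝ᵥ u = 1 := by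
    rw [← hw]; simp [dotProduct, hu]
  -- Positive entries: passing to absolute values cannot decrease the form, so `u` is a maximizer
  -- too.
  have hul : l ≤ u ⬝ᵥ M *ᵥ u := by
    simp only [hl, dotProduct, mulVec, Finset.mul_sum, hu]
    refine Finset.sum_le_sum fun i _ => Finset.sum_le_sum fun j _ => ?_
    calc w i * (M i j * w j) ≤ |w i * (M i j * w j)| := le_abs_self _
      _ = _ := by rw [abs_mul, abs_mul, abs_of_pos (hpos i j)]
  have hpsd : (l • (1 : Matrix ι ι ℝ) - M).PosSemidef := by
    refine PosSemidef.of_dotProduct_mulVec_nonneg ?_ fun x => ?_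
    · refine IsHermitian.ext fun i j => ?_
      simp [Matrix.one_apply, hsymm.apply, eq_comm]
    · have := hmax x
      simp only [star_trivial, sub_mulVec, smul_mulVec, one_mulVec, dotProduct_sub,
        dotProduct_smul, smul_eq_mul]
      linarith
  -- The positive semidefinite form of `l - M` vanishes at `u`, hence `u` lies in its kernel.
  have hMu : M *ᵥ u = l • u := by
    have h0 : u ⬝ᵥ (l • (1 : Matrix ι ι ℝ) - M) *ᵥ u = 0 := by
      have h1 := hpsd.dotProduct_mulVec_nonneg u
      rw [star_trivial] at h1
      refine le_antisymm ?_ h1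
      simp only [sub_mulVec, smul_mulVec, one_mulVec, dotProduct_sub,
        dotProduct_smul, smul_eq_mul, huu]
      linarith
    have h2 := (hpsd.dotProduct_mulVec_zero_iff u).1 (by rwa [star_trivial])
    rw [sub_mulVec, smul_mulVec, one_mulVec, sub_eq_zero] at h2
    exact h2.symm
  have hu0 : u ≠ 0 := by rintro h; simp [h] at huu
  have hupos : ∀ i, 0 < u i := by
    obtain ⟨j, hj⟩ := Function.ne_iff.1 hu0
    intro i
    have h1 : 0 < (M *ᵥ u) i := by
      refine Finset.sum_pos' (fun k _ => mul_nonneg (hpos i k).le (abs_nonneg _))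
        ⟨j, Finset.mem_univ _, mul_pos (hpos i j) (lt_of_le_of_ne (abs_nonneg _) (Ne.symm hj))⟩
    rw [hMu] at h1
    refine lt_of_le_of_ne (abs_nonneg _) fun h => ?_
    rw [Pi.smul_apply, smul_eq_mul, ← h, mul_zero] at h1
    exact lt_irrefl _ h1
  have hgreat : IsGreatest {m : ℝ | Module.End.HasEigenvalue (Matrix.toLin' M) m} l := by
    constructor
    · exact Module.End.hasEigenvalue_of_hasEigenvector
        (Module.End.hasEigenvector_iff.2 ⟨Module.End.mem_eigenspace_iff.2 (by simpa using hMu), hu0⟩)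
    · intro m hm
      obtain ⟨x, hx⟩ := hm.exists_hasEigenvector
      have h1 := hx.apply_eq_smul
      rw [toLin'_apply] at h1
      have h2 := hmax x
      have hxx : 0 < x ⬝ᵥ x := by
        have := dotProduct_star_self_pos_iff.2 hx.2
        simpa using this
      rw [h1, dotProduct_smul, smul_eq_mul] at h2
      exact le_of_mul_le_mul_right h2 hxx
  refine ⟨u, hupos, ?_⟩
  rw [largestEigenvalue, hgreat.csSup_eq, hMu]

end Perron

end LatticeWalk

namespace LatticeWalk

noncomputable section

set_option linter.unusedSectionVars false

/-! ### Increment sequences, and independence of past and future. -/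

section Canonical

variable {E : Type*} [AddCommGroup E]

/-- Partial sums of a sequence of increments. -/
def walk (e : ℕ → E) (j : ℕ) : E := ∑ i ∈ Finset.range j, e i

/-- The increments from time `m` on. -/
def shift (m : ℕ) (e : ℕ → E) : ℕ → E := fun i => e (m + i)

/-- The increments before time `m`, followed by zeros. -/
def past (m : ℕ) (e : ℕ → E) : ℕ → E := fun i => if i < m then e i else 0

/-- The number of visits to `A` up to time `n` of the walk started at `x` with increments `e`. -/
def visits (A : Set E) (x : E) (e : ℕ → E) (n : ℕ) : ℕ :=
  ∑ j ∈ Finset.range (n + 1), A.indicator 1 (x + walk e j)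

@[simp] lemma walk_zero (e : ℕ → E) : walk e 0 = 0 := by simp [walk]

lemma walk_succ_eq_head_add (e : ℕ → E) (j : ℕ) : walk e (j + 1) = e 0 + walk (shift 1 e) j := by
  simp only [walk, shift, Finset.sum_range_succ', add_comm]

lemma walk_add (e : ℕ → E) (m j : ℕ) : walk e (m + j) = walk e m + walk (shift m e) j := by
  simp only [walk, shift, Finset.sum_range_add]

lemma shift_shift (m n : ℕ) (e : ℕ → E) : shift m (shift n e) = shift (n + m) e := by
  funext i; simp [shift, add_assoc]

lemma walk_past {m j : ℕ} (h : j ≤ m) (e : ℕ → E) : walk (past m e) j = walk e j :=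
  Finset.sum_congr rfl fun _ hi => if_pos ((Finset.mem_range.1 hi).trans_le h)

lemma visits_mono_right (A : Set E) (x : E) (e : ℕ → E) : Monotone (visits A x e) := by
  intro m n h
  exact Finset.sum_le_sum_of_subset (Finset.range_mono (by omega))

open Classical in
lemma visits_succ (A : Set E) (x : E) (e : ℕ → E) (n : ℕ) :
    visits A x e (n + 1) = (if x ∈ A then 1 else 0) + visits A (x + e 0) (shift 1 e) n := by
  rw [visits, Finset.sum_range_succ', add_comm]
  congr 1
  · simp [Set.indicator_apply]
  · simp only [visits, walk_succ_eq_head_add, add_assoc]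

open Classical in
lemma visits_zero (A : Set E) (x : E) (e : ℕ → E) :
    visits A x e 0 = if x ∈ A then 1 else 0 := by
  rw [visits, Finset.sum_range_one]
  simp [Set.indicator_apply]

lemma visits_past {m n : ℕ} (h : n ≤ m) (A : Set E) (x : E) (e : ℕ → E) :
    visits A x (past m e) n = visits A x e n := by
  refine Finset.sum_congr rfl fun j hj => ?_
  rw [walk_past (by rw [Finset.mem_range] at hj; omega)]

lemma shift_past_of_le {m i L : ℕ} (h : i + L ≤ m) (e : ℕ → E) :
    past L (shift i (past m e)) = past L (shift i e) := by
  funext j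
  simp only [past, shift]
  split_ifs <;> first | rfl | omega

variable [Countable E] [MeasurableSpace E] [DiscreteMeasurableSpace E]

@[fun_prop]
lemma measurable_walk (j : ℕ) : Measurable fun e : ℕ → E => walk e j := by
  have : MeasurableAdd₂ E := ⟨Measurable.of_discrete⟩
  unfold walk
  fun_prop

@[fun_prop]
lemma measurable_shift (m : ℕ) : Measurable (shift m : (ℕ → E) → ℕ → E) := by
  unfold shift; fun_prop

@[fun_prop]
lemma measurable_visits (A : Set E) (x : E) (n : ℕ) :
    Measurable fun e : ℕ → E => visits A x e n := by
  unfold visits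
  refine Finset.measurable_sum _ fun j _ => ?_
  exact (Measurable.of_discrete (f := fun y : E => A.indicator (1 : E → ℕ) (x + y))).comp
    (measurable_walk j)

lemma measurable_visits_uncurry (A : Set E) (x : E) (n : ℕ) :
    Measurable fun q : E × (ℕ → E) => visits A (x + q.1) q.2 n :=
  measurable_from_prod_countable_right fun z => measurable_visits A (x + z) n

variable (μ : Measure E) [IsProbabilityMeasure μ]

/-- The law of a sequence of independent increments with law `μ`. -/
abbrev seqLaw : Measure (ℕ → E) := Measure.infinitePi fun _ : ℕ => μ

lemma map_shift (m : ℕ) : (seqLaw μ).map (shift m) = seqLaw μ :=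
  Measure.map_infinitePi_infinitePi_of_inj (P := fun _ : ℕ => μ) (f := fun i => m + i)
    (add_right_injective m)

lemma iIndepFun_coord : iIndepFun (fun (i : ℕ) (e : ℕ → E) => e i) (seqLaw μ) :=
  iIndepFun_infinitePi (P := fun _ : ℕ => μ) (X := fun _ x => x) fun _ => measurable_id

/-- The two maps depend on disjoint sets of coordinates; the padding zeros of `past` generate only
the trivial σ-algebra. -/
lemma indepFun_past_shift (m : ℕ) :
    IndepFun (past m : (ℕ → E) → ℕ → E) (shift m) (seqLaw μ) := by
  have h := indep_iSup_of_disjoint (fun i => (measurable_pi_apply i).comap_le)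
    ((iIndepFun_iff_iIndep _ _ _).1 (iIndepFun_coord μ)) (S := {i | i < m}) (T := {i | m ≤ i})
    (Set.disjoint_left.2 fun i (hi : i < m) (hi' : m ≤ i) => by omega)
  rw [IndepFun_iff_Indep]
  refine indep_of_indep_of_le_left (indep_of_indep_of_le_right h ?_) ?_
  · rw [MeasurableSpace.pi, MeasurableSpace.comap_iSup]
    refine iSup_le fun i => ?_
    rw [MeasurableSpace.comap_comp]
    exact le_iSup₂_of_le (f := fun j (_ : j ∈ {i | m ≤ i}) =>
      MeasurableSpace.comap (fun e : ℕ → E => e j) inferInstance) (m + i)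
      (Nat.le_add_right m i) le_rfl
  · rw [MeasurableSpace.pi, MeasurableSpace.comap_iSup]
    refine iSup_le fun i => ?_
    rw [MeasurableSpace.comap_comp]
    by_cases hi : i < m
    · refine le_iSup₂_of_le (f := fun j (_ : j ∈ {i | i < m}) =>
        MeasurableSpace.comap (fun e : ℕ → E => e j) inferInstance) i hi (le_of_eq ?_)
      congr 1
      funext e
      simp [past, hi]
    · have h0 : (fun e : ℕ → E => e i) ∘ past m = fun _ => 0 := by
        funext e; simp [past, hi]
      rw [h0, MeasurableSpace.comap_const]
      exact bot_le

lemma real_past_inter_shift (m : ℕ) {B C : Set (ℕ → E)} (hB : MeasurableSet B)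
    (hC : MeasurableSet C) :
    (seqLaw μ).real (past m ⁻¹' B ∩ shift m ⁻¹' C) =
      (seqLaw μ).real (past m ⁻¹' B) * (seqLaw μ).real C := by
  have h := (indepFun_past_shift μ m).measure_inter_preimage_eq_mul B C hB hC
  rw [measureReal_def, h, ENNReal.toReal_mul, measureReal_def, measureReal_def]
  rw [← Measure.map_apply (measurable_shift m) hC, map_shift]

lemma map_head_shift :
    (seqLaw μ).map (fun e => (e 0, shift 1 e)) = μ.prod (seqLaw μ) := by
  have h : IndepFun (fun e : ℕ → E => e 0) (shift 1) (seqLaw μ) := by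
    have := (indepFun_past_shift μ 1).comp (φ := fun e : ℕ → E => e 0) (ψ := id)
      (measurable_pi_apply (X := fun _ : ℕ => E) 0) measurable_id
    simpa [Function.comp_def, past] using this
  rw [(indepFun_iff_map_prod_eq_prod_map_map (measurable_pi_apply 0).aemeasurable
    (by fun_prop)).1 h, map_shift,
    Measure.infinitePi_map_eval]

/-- Conditioning on the first increment. -/
lemma real_head_shift {D : Set (E × (ℕ → E))} (hD : MeasurableSet D) :
    (seqLaw μ).real {e | (e 0, shift 1 e) ∈ D} =
      ∫ z, (seqLaw μ).real {e | (z, e) ∈ D} ∂μ := by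
  have h : {e : ℕ → E | (e 0, shift 1 e) ∈ D} = (fun e => (e 0, shift 1 e)) ⁻¹' D := rfl
  rw [h, ← map_measureReal_apply (by fun_prop) hD, map_head_shift, measureReal_def,
    Measure.prod_apply hD, integral_eq_lintegral_of_nonneg_ae
      (Eventually.of_forall fun _ => measureReal_nonneg)
      Measurable.of_discrete.aestronglyMeasurable]
  congr 1
  refine lintegral_congr fun z => ?_
  rw [ofReal_measureReal]
  rfl

end Canonical

end

end LatticeWalk

namespace LatticeWalk

noncomputable section

set_option linter.unusedSectionVars false

/-! ### Heat kernel, potentials, and geometric bounds on the number of visits. -/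

section Potential

variable {E : Type*} [AddCommGroup E] [Countable E] [MeasurableSpace E] [DiscreteMeasurableSpace E]
  (μ : Measure E) [IsProbabilityMeasure μ]

lemma integrable_of_abs_le {f : E → ℝ} (C : ℝ) (h : ∀ x, |f x| ≤ C) : Integrable f μ :=
  Integrable.of_bound Measurable.of_discrete.aestronglyMeasurable C (Eventually.of_forall h)

/-- The probability that the walk with step law `μ` is at `x` at time `j`. -/
def heat (j : ℕ) (x : E) : ℝ := (seqLaw μ).real {e | walk e j = x}

lemma heat_nonneg (j : ℕ) (x : E) : 0 ≤ heat μ j x := measureReal_nonneg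

lemma heat_le_one (j : ℕ) (x : E) : heat μ j x ≤ 1 := measureReal_le_one

lemma measurableSet_walk_eq (j : ℕ) (x : E) : MeasurableSet {e : ℕ → E | walk e j = x} :=
  measurable_walk j (MeasurableSet.of_discrete (s := {x}))

lemma heat_zero_self : heat μ 0 0 = 1 := by
  simp [heat]

lemma heat_zero_of_ne {x : E} (hx : x ≠ 0) : heat μ 0 x = 0 := by
  simp [heat, hx.symm]

lemma integrable_heat (j : ℕ) (f : E → E) : Integrable (fun z => heat μ j (f z)) μ :=
  integrable_of_abs_le μ 1 fun z => by
    rw [abs_of_nonneg (heat_nonneg μ _ _)]; exact heat_le_one μ _ _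

lemma heat_succ (j : ℕ) (x : E) : heat μ (j + 1) x = ∫ z, heat μ j (x - z) ∂μ := by
  have hD : MeasurableSet {q : E × (ℕ → E) | q.1 + walk q.2 j = x} := by
    refine (measurable_from_prod_countable_right (f := fun q : E × (ℕ → E) => q.1 + walk q.2 j)
      fun z => ?_) (MeasurableSet.of_discrete (s := {x}))
    exact (Measurable.of_discrete (f := fun y : E => z + y)).comp (measurable_walk j)
  have h := real_head_shift μ hD
  simp only [Set.mem_ofPred_eq, ← walk_succ_eq_head_add] at h
  rw [heat, h]
  refine integral_congr_ae (Eventually.of_forall fun z => ?_)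
  simp only [heat, eq_sub_iff_add_eq']

lemma heat_neg (hμ : μ.map (fun z => -z) = μ) (j : ℕ) (x : E) : heat μ j (-x) = heat μ j x := by
  induction j generalizing x with
  | zero =>
    rcases eq_or_ne x 0 with rfl | hx
    · simp
    · rw [heat_zero_of_ne μ hx, heat_zero_of_ne μ (neg_ne_zero.2 hx)]
  | succ j ih =>
    have hcov : ∀ f : E → ℝ, ∫ z, f z ∂μ = ∫ z, f (-z) ∂μ := fun f => by
      conv_lhs => rw [← hμ, integral_map Measurable.of_discrete.aemeasurable
        Measurable.of_discrete.aestronglyMeasurable]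
    rw [heat_succ, heat_succ, hcov fun z => heat μ j (x - z)]
    refine integral_congr_ae (Eventually.of_forall fun z => ?_)
    simp only [← ih (x - -z)]
    congr 1
    abel

lemma mul_heat_le_heat_succ (j : ℕ) (x z : E) :
    μ.real {z} * heat μ j (x - z) ≤ heat μ (j + 1) x := by
  rw [heat_succ]
  have h : ∫ w in ({z} : Set E), heat μ j (x - w) ∂μ = μ.real {z} * heat μ j (x - z) := by
    rw [integral_singleton, smul_eq_mul]
  rw [← h]
  exact setIntegral_le_integral (integrable_heat μ j _)
    (Eventually.of_forall fun _ => heat_nonneg μ _ _)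

/-- By symmetry the atoms of `μ` are closed under negation, so every element of the group they
generate is a sum of atoms, that is, a possible path. -/
lemma exists_heat_pos (hμ : μ.map (fun z => -z) = μ)
    (hgen : AddSubgroup.closure {z : E | 0 < μ.real {z}} = ⊤) (x : E) :
    ∃ j, 0 < heat μ j x := by
  have hneg : ∀ z : E, 0 < μ.real {z} → 0 < μ.real {-z} := by
    intro z hz
    have h : μ.real {-z} = μ.real {z} := by
      conv_lhs => rw [← hμ, map_measureReal_apply Measurable.of_discrete
        MeasurableSet.of_discrete]
      congr 1
      ext w
      simp
    rwa [h]
  have hadd : ∀ z : E, 0 < μ.real {z} → ∀ y, (∃ j, 0 < heat μ j y) → ∃ j, 0 < heat μ j (z + y) := by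
    rintro z hz y ⟨j, hj⟩
    refine ⟨j + 1, (mul_pos hz ?_).trans_le (mul_heat_le_heat_succ μ j (z + y) z)⟩
    simpa using hj
  have hx : x ∈ AddSubgroup.closure {z : E | 0 < μ.real {z}} := hgen ▸ AddSubgroup.mem_top x
  induction hx using AddSubgroup.closure_induction_left with
  | zero => exact ⟨0, by rw [heat_zero_self]; exact one_pos⟩
  | add_left z hz y _ ih => exact hadd z hz y ih
  | neg_add_cancel z hz y _ ih => exact hadd (-z) (hneg z hz) y ih

/-- The probability that the walk started at `x` visits `A` at least `k` times up to time `n`. -/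
def visitProb (A : Set E) (n : ℕ) (x : E) (k : ℕ) : ℝ :=
  (seqLaw μ).real {e | k ≤ visits A x e n}

lemma measurableSet_le_visits (A : Set E) (n : ℕ) (x : E) (k : ℕ) :
    MeasurableSet {e : ℕ → E | k ≤ visits A x e n} :=
  measurableSet_le measurable_const (measurable_visits A x n)

lemma visitProb_nonneg (A : Set E) (n : ℕ) (x : E) (k : ℕ) : 0 ≤ visitProb μ A n x k :=
  measureReal_nonneg

lemma visitProb_le_one (A : Set E) (n : ℕ) (x : E) (k : ℕ) : visitProb μ A n x k ≤ 1 :=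
  measureReal_le_one

lemma integrable_visitProb (A : Set E) (n : ℕ) (x : E) (k : ℕ) :
    Integrable (fun z => visitProb μ A n (x + z) k) μ :=
  integrable_of_abs_le μ 1 fun z => by
    rw [abs_of_nonneg (visitProb_nonneg μ _ _ _ _)]; exact visitProb_le_one μ _ _ _ _

lemma visitProb_succ_of_notMem {A : Set E} {x : E} (hx : x ∉ A) (n k : ℕ) :
    visitProb μ A (n + 1) x k = ∫ z, visitProb μ A n (x + z) k ∂μ := by
  have hD : MeasurableSet {q : E × (ℕ → E) | k ≤ visits A (x + q.1) q.2 n} :=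
    measurableSet_le measurable_const (measurable_visits_uncurry A x n)
  have h := real_head_shift μ hD
  simp only [Set.mem_ofPred_eq] at h
  simpa [visitProb, visits_succ, hx] using h

lemma visitProb_succ_of_mem {A : Set E} {x : E} (hx : x ∈ A) (n k : ℕ) :
    visitProb μ A (n + 1) x (k + 1) = ∫ z, visitProb μ A n (x + z) k ∂μ := by
  have hD : MeasurableSet {q : E × (ℕ → E) | k ≤ visits A (x + q.1) q.2 n} :=
    measurableSet_le measurable_const (measurable_visits_uncurry A x n)
  have h := real_head_shift μ hD
  simp only [Set.mem_ofPred_eq] at h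
  simpa [visitProb, visits_succ, hx, add_comm 1] using h

lemma one_le_visits_of_mem {A : Set E} {x : E} (hx : x ∈ A) (e : ℕ → E) (n : ℕ) :
    1 ≤ visits A x e n := by
  refine le_trans ?_ (visits_mono_right A x e (Nat.zero_le n))
  simp [visits_zero, hx]

lemma visitProb_one_of_mem {A : Set E} {x : E} (hx : x ∈ A) (n : ℕ) :
    visitProb μ A n x 1 = 1 := by
  simp [visitProb, one_le_visits_of_mem hx]

/-- The expected `v`-weight of the visits to `A` up to time `n` of the walk started at `x`. -/
def potential (A : Finset E) (v : E → ℝ) (n : ℕ) (x : E) : ℝ :=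
  ∑ j ∈ Finset.range (n + 1), ∑ y ∈ A, v y * heat μ j (y - x)

variable {A : Finset E} {v : E → ℝ}

lemma potential_mono (hv : ∀ x ∈ A, 0 < v x) (x : E) :
    Monotone fun n => potential μ A v n x := by
  intro m n h
  refine Finset.sum_le_sum_of_subset_of_nonneg (Finset.range_mono (by omega)) fun j _ _ => ?_
  exact Finset.sum_nonneg fun y hy => mul_nonneg (hv y hy).le (heat_nonneg μ _ _)

lemma potential_zero_of_mem {x : E} (hx : x ∈ A) : potential μ A v 0 x = v x := by
  rw [potential, Finset.sum_range_one, Finset.sum_eq_single_of_mem x hx]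
  · simp [heat_zero_self]
  · intro y _ hy
    rw [heat_zero_of_ne μ (sub_ne_zero.2 hy), mul_zero]

lemma potential_zero_of_notMem {x : E} (hx : x ∉ A) : potential μ A v 0 x = 0 := by
  rw [potential, Finset.sum_range_one]
  refine Finset.sum_eq_zero fun y hy => ?_
  rw [heat_zero_of_ne μ (sub_ne_zero.2 (by rintro rfl; exact hx hy)), mul_zero]

lemma integrable_potential (n : ℕ) (x : E) :
    Integrable (fun z => potential μ A v n (x + z)) μ :=
  integrable_finsetSum _ fun j _ => integrable_finsetSum _ fun y _ =>
    (integrable_heat μ j fun z => y - (x + z)).const_mul (v y)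

/-- The one-step equation behind both visit bounds: the time-zero term is `v x` on `A` and `0` off
`A`, and the remaining terms are averaged over the first increment. -/
lemma potential_succ (n : ℕ) (x : E) :
    potential μ A v (n + 1) x = potential μ A v 0 x + ∫ z, potential μ A v n (x + z) ∂μ := by
  simp only [potential]
  rw [Finset.sum_range_succ', add_comm, zero_add, Finset.sum_range_one,
    integral_finsetSum _ fun j _ => integrable_finsetSum _ fun y _ =>
      (integrable_heat μ j fun z => y - (x + z)).const_mul (v y)]
  congr 1
  refine Finset.sum_congr rfl fun j _ => ?_
  rw [integral_finsetSum _ fun y _ =>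
      (integrable_heat μ j fun z => y - (x + z)).const_mul (v y)]
  refine Finset.sum_congr rfl fun y _ => ?_
  rw [integral_const_mul, heat_succ]
  simp only [sub_add_eq_sub_sub]

/-- If `potential n ≤ L v` on `A`, the number of visits to `A` has a geometric tail of
ratio `1 - 1 / L`. -/
theorem visitProb_le (hv : ∀ x ∈ A, 0 < v x) {L C : ℝ} (hL : 1 < L)
    (hpot : ∀ n, ∀ x ∈ A, potential μ A v n x ≤ L * v x) (hC0 : 0 ≤ C)
    (hC : ∀ x ∈ A, 1 ≤ C * v x) (n : ℕ) (x : E) (k : ℕ) :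
    visitProb μ A n x (k + 1) ≤ C * (1 - 1 / L) ^ k * potential μ A v n x := by
  have hr : 0 ≤ 1 - 1 / L := by
    rw [sub_nonneg, div_le_one (by linarith)]; exact hL.le
  have hone : ∀ n, ∀ x ∈ A, visitProb μ A n x 1 ≤ C * (1 - 1 / L) ^ 0 * potential μ A v n x := by
    intro n x hx
    have h1 := potential_mono μ hv x (Nat.zero_le n)
    simp only [potential_zero_of_mem μ hx] at h1
    calc visitProb μ A n x 1 ≤ 1 := visitProb_le_one μ _ _ _ _
      _ ≤ C * v x := hC x hx
      _ ≤ C * (1 - 1 / L) ^ 0 * potential μ A v n x := by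
        rw [pow_zero, mul_one]; gcongr
  induction n generalizing x k with
  | zero =>
    by_cases hx : x ∈ A
    · cases k with
      | zero => exact hone 0 x hx
      | succ k =>
        have h0 : visitProb μ A 0 x (k + 1 + 1) = 0 := by
          simp [visitProb, visits_zero, hx]
        rw [h0, potential_zero_of_mem μ hx]
        have := hv x hx
        positivity
    · have h0 : visitProb μ A 0 x (k + 1) = 0 := by
        simp [visitProb, visits_zero, hx]
      rw [h0, potential_zero_of_notMem μ hx, mul_zero]
  | succ n ih =>
    have hint : ∀ k, ∫ z, visitProb μ A n (x + z) (k + 1) ∂μ ≤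
        C * (1 - 1 / L) ^ k * (potential μ A v (n + 1) x - potential μ A v 0 x) := by
      intro k
      rw [potential_succ, add_sub_cancel_left, ← integral_const_mul]
      exact integral_mono (integrable_visitProb μ _ _ _ _)
        ((integrable_potential μ n x).const_mul _) fun z => ih (x + z) k
    by_cases hx : x ∈ A
    · cases k with
      | zero => exact hone (n + 1) x hx
      | succ k =>
        rw [visitProb_succ_of_mem μ (A := (A : Set E)) hx]
        refine (hint k).trans ?_
        rw [potential_zero_of_mem μ hx, pow_succ, ← mul_assoc, mul_assoc _ (1 - 1 / L)]
        refine mul_le_mul_of_nonneg_left ?_ (by positivity)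
        -- Since `h ≤ L v` on `A`, removing the current visit leaves `h - v ≤ (1 - 1 / L) h`: this
        -- is the gain of one factor.
        have h1 := hpot (n + 1) x hx
        have h2 : potential μ A v (n + 1) x / L ≤ v x := by
          rw [div_le_iff₀ (by linarith)]; linarith
        have h3 : (1 - 1 / L) * potential μ A v (n + 1) x =
          potential μ A v (n + 1) x - potential μ A v (n + 1) x / L := by ring
        linarith
    · rw [visitProb_succ_of_notMem μ (A := (A : Set E)) hx]
      refine (hint k).trans (le_of_eq ?_)
      rw [potential_zero_of_notMem μ hx, sub_zero]

/-- If `potential n ≥ (1 + L r) v` on `A` for large `n`, then `k` visits to `A` within a time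
linear in `k` have probability at least of order `r ^ k`. -/
theorem le_visitProb {L r c : ℝ} (hr : 0 ≤ r) (hc : 0 ≤ c)
    (hpot : ∀ n, ∀ x ∈ A, potential μ A v n x ≤ L * v x)
    (hcL : ∀ x ∈ A, c * (L * v x) ≤ 1) {T : ℕ}
    (hT : ∀ n, T < n → ∀ x ∈ A, r * (L * v x) ≤ potential μ A v n x - v x)
    (k s : ℕ) (x : E) :
    c * r ^ k * potential μ A v s x ≤ visitProb μ A (k * (T + 1) + s) x (k + 1) := by
  -- Off `A` the truncated potential is a one-step average, so the bound passes from `s` to `s + 1`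
  -- with `k` fixed. It thus suffices to treat starting points in `A`, for all `s`.
  have hout : ∀ k s, (∀ x, c * r ^ k * potential μ A v s x ≤
      visitProb μ A (k * (T + 1) + s) x (k + 1)) → ∀ x ∉ A, c * r ^ k * potential μ A v (s + 1) x ≤
      visitProb μ A (k * (T + 1) + (s + 1)) x (k + 1) := by
    intro k s ih x hx
    rw [potential_succ, potential_zero_of_notMem μ hx, zero_add, ← integral_const_mul, ← add_assoc,
      visitProb_succ_of_notMem μ (A := (A : Set E)) hx]
    exact integral_mono ((integrable_potential μ s x).const_mul _)
      (integrable_visitProb μ _ _ _ _) fun z => ih (x + z)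
  have hout0 : ∀ k, ∀ x ∉ A, c * r ^ k * potential μ A v 0 x ≤
      visitProb μ A (k * (T + 1) + 0) x (k + 1) := by
    intro k x hx
    rw [potential_zero_of_notMem μ hx, mul_zero]
    exact visitProb_nonneg μ _ _ _ _
  have key : ∀ k, (∀ s, ∀ x ∈ A, c * r ^ k * potential μ A v s x ≤
      visitProb μ A (k * (T + 1) + s) x (k + 1)) → ∀ s x, c * r ^ k * potential μ A v s x ≤
      visitProb μ A (k * (T + 1) + s) x (k + 1) := by
    intro k hin s
    induction s with
    | zero => classical exact fun x => if hx : x ∈ A then hin 0 x hx else hout0 k x hx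
    | succ s ih => classical exact fun x => if hx : x ∈ A then hin (s + 1) x hx else hout k s ih x hx
  induction k generalizing s x with
  | zero =>
    refine key 0 (fun s x hx => ?_) s x
    rw [zero_add, visitProb_one_of_mem μ (A := (A : Set E)) hx, pow_zero, mul_one]
    exact (mul_le_mul_of_nonneg_left (hpot s x hx) hc).trans (hcL x hx)
  | succ k ih =>
    refine key (k + 1) (fun s x hx => ?_) s x
    -- One step leaves the visited point and `T` extra steps are kept in reserve, so the potential
    -- in play has index `T + s + 1 > T`, as `hT` requires.
    have hn : (k + 1) * (T + 1) + s = (k * (T + 1) + (T + s)) + 1 := by ring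
    rw [hn, visitProb_succ_of_mem μ (A := (A : Set E)) hx]
    have h1 : c * r ^ k * (potential μ A v (T + s + 1) x - v x) ≤
        ∫ z, visitProb μ A (k * (T + 1) + (T + s)) (x + z) (k + 1) ∂μ := by
      rw [potential_succ, potential_zero_of_mem μ hx, add_sub_cancel_left, ← integral_const_mul]
      exact integral_mono ((integrable_potential μ _ x).const_mul _)
        (integrable_visitProb μ _ _ _ _) fun z => ih (T + s) (x + z)
    refine le_trans ?_ h1
    calc c * r ^ (k + 1) * potential μ A v s x ≤ c * r ^ (k + 1) * (L * v x) := by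
          gcongr; exact hpot s x hx
      _ = c * r ^ k * (r * (L * v x)) := by ring
      _ ≤ _ := by gcongr; exact hT _ (by omega) x hx

end Potential

end

end LatticeWalk

namespace LatticeWalk

noncomputable section

set_option linter.unusedSectionVars false

/-! ### Summability of the heat kernel, and Borel–Cantelli in both directions. -/

section AlmostSure

variable {E : Type*} [AddCommGroup E] [Countable E] [MeasurableSpace E] [DiscreteMeasurableSpace E]
  (μ : Measure E) [IsProbabilityMeasure μ]

lemma real_walk_eq_inter_shift (n : ℕ) (x : E) {C : Set (ℕ → E)} (hC : MeasurableSet C) :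
    (seqLaw μ).real ({e | walk e n = x} ∩ shift n ⁻¹' C) = heat μ n x * (seqLaw μ).real C := by
  have h := real_past_inter_shift μ n (measurableSet_walk_eq n x) hC
  have h' : past n ⁻¹' {e : ℕ → E | walk e n = x} = {e | walk e n = x} := by
    ext e; simp [walk_past le_rfl]
  rwa [h'] at h

lemma heat_mul_heat_le (n j : ℕ) (x y : E) :
    heat μ n x * heat μ j y ≤ heat μ (n + j) (x + y) := by
  rw [heat.eq_1 μ j, ← real_walk_eq_inter_shift μ n x (measurableSet_walk_eq j y)]
  refine measureReal_mono ?_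
  rintro e ⟨h1, h2⟩
  simp only [Set.mem_ofPred_eq, Set.mem_preimage] at h1 h2 ⊢
  rw [walk_add, h1, h2]

/-- Decomposing according to the last visit to the origin. -/
lemma summable_heat_zero (htrans : ∀ᵐ e ∂seqLaw μ, {n | walk e n = 0}.Finite) :
    Summable fun n => heat μ n 0 := by
  -- `N` is the event of no return. The events `D n`, that the last visit to the origin is at time
  -- `n`, are disjoint with probability `heat μ n 0` times that of `N`; transience forces `N` to
  -- have positive probability.
  set N : Set (ℕ → E) := {e | ∀ j, walk e (j + 1) ≠ 0} with hN
  have hNm : MeasurableSet N := by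
    rw [hN, Set.ofPred_forall]
    exact MeasurableSet.iInter fun j => (measurableSet_walk_eq (j + 1) 0).compl
  set D : ℕ → Set (ℕ → E) := fun n => {e | walk e n = 0} ∩ shift n ⁻¹' N with hD
  have hDm : ∀ n, MeasurableSet (D n) := fun n =>
    (measurableSet_walk_eq n 0).inter (measurable_shift n hNm)
  have hDr : ∀ n, (seqLaw μ).real (D n) = heat μ n 0 * (seqLaw μ).real N := fun n =>
    real_walk_eq_inter_shift μ n 0 hNm
  have hlt : ∀ m n, m < n → Disjoint (D m) (D n) := by
    intro m n h
    rw [Set.disjoint_left]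
    rintro e ⟨h1, h2⟩ ⟨h3, -⟩
    obtain ⟨j, rfl⟩ := Nat.exists_eq_add_of_lt h
    refine h2 j ?_
    rw [Set.mem_ofPred_eq] at h1 h3
    rwa [add_assoc, walk_add, h1, zero_add] at h3
  have hdisj : Pairwise (Function.onFun Disjoint D) := by
    intro m n hmn
    rcases lt_or_gt_of_ne hmn with h | h
    · exact hlt m n h
    · exact (hlt n m h).symm
  have hsum : Summable fun n => (seqLaw μ).real (D n) := by
    refine ENNReal.summable_toReal ?_
    rw [← measure_iUnion hdisj hDm]
    exact measure_ne_top _ _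
  have hpos : 0 < (seqLaw μ).real N := by
    refine lt_of_le_of_ne measureReal_nonneg fun h0 => ?_
    have hnull : seqLaw μ (⋃ n, D n) = 0 := by
      refine measure_iUnion_null fun n => ?_
      rw [← measureReal_eq_zero_iff, hDr, ← h0, mul_zero]
    have hcov : ∀ᵐ e ∂seqLaw μ, e ∈ ⋃ n, D n := by
      filter_upwards [htrans] with e he
      obtain ⟨n, hn, hmax⟩ := he.exists_maximal ⟨0, walk_zero e⟩
      refine Set.mem_iUnion.2 ⟨n, hn, fun j hj => ?_⟩
      have h1 : n + (j + 1) ∈ {n | walk e n = 0} := by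
        rw [Set.mem_ofPred_eq, walk_add, hj, add_zero]; exact hn
      have := hmax h1 (by omega)
      omega
    have hfalse : ∀ᵐ e ∂seqLaw μ, False := by
      filter_upwards [hcov, measure_eq_zero_iff_ae_notMem.1 hnull] with e h1 h2
      exact h2 h1
    exact hfalse.exists.choose_spec
  simp only [hDr] at hsum
  exact (summable_mul_right_iff hpos.ne').1 hsum

/-- Completing a path to `x` by a fixed possible path to `-x` gives a return to the origin, so the
sum at `x` is controlled by the one at `0`. -/
lemma summable_heat (hμ : μ.map (fun z => -z) = μ)
    (hgen : AddSubgroup.closure {z : E | 0 < μ.real {z}} = ⊤)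
    (htrans : ∀ᵐ e ∂seqLaw μ, {n | walk e n = 0}.Finite) (x : E) :
    Summable fun n => heat μ n x := by
  obtain ⟨j, hj⟩ := exists_heat_pos μ hμ hgen (-x)
  rw [← summable_mul_right_iff hj.ne']
  refine Summable.of_nonneg_of_le (fun n => mul_nonneg (heat_nonneg μ _ _) (heat_nonneg μ _ _))
    (fun n => ?_) ((summable_nat_add_iff j).2 (summable_heat_zero μ htrans))
  simpa using heat_mul_heat_le μ n j x (-x)

/-- Restart at the first entrance to `A`. This replaces infinitely many starting points by `n + 1`
times and the points of `A`. -/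
lemma visits_eq_zero_or_le (A : Set E) (n : ℕ) (x : E) (e : ℕ → E) :
    visits A x e n = 0 ∨ ∃ m ≤ n, ∃ a ∈ A, visits A x e n ≤ visits A a (shift m e) n := by
  have hs0 : shift 0 e = e := by funext i; simp [shift]
  induction n generalizing x e with
  | zero =>
    by_cases hx : x ∈ A
    · exact Or.inr ⟨0, le_rfl, x, hx, by simp [visits_zero]⟩
    · exact Or.inl (by simp [visits_zero, hx])
  | succ n ih =>
    by_cases hx : x ∈ A
    · exact Or.inr ⟨0, Nat.zero_le _, x, hx, by rw [hs0]⟩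
    · have h1 : visits A x e (n + 1) = visits A (x + e 0) (shift 1 e) n := by
        rw [visits_succ]; simp [hx]
      rw [h1]
      rcases ih (x + e 0) (shift 1 e) (by funext i; simp [shift]) with h | ⟨m, hm, a, ha, h⟩
      · exact Or.inl h
      · rw [shift_shift] at h
        exact Or.inr ⟨1 + m, by omega, a, ha, h.trans (visits_mono_right A a _ (Nat.le_succ n))⟩

lemma measurableSet_exists_visits (A : Finset E) (k : ℕ) :
    MeasurableSet {e : ℕ → E | ∃ a ∈ A, ∃ n, k ≤ visits A a e n} := by
  have h : {e : ℕ → E | ∃ a ∈ A, ∃ n, k ≤ visits A a e n} =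
      ⋃ a ∈ A, ⋃ n, {e | k ≤ visits A a e n} := by
    ext e; simp
  rw [h]
  exact Finset.measurableSet_biUnion _ fun a _ =>
    MeasurableSet.iUnion fun n => measurableSet_le_visits (A : Set E) n a k

/-- The increments are stationary, and the events increase with `n`, so the union over `n` costs
nothing; only the choice of `a ∈ A` brings a factor. -/
lemma measure_exists_visits_le {A : Finset E} {C ρ : ℝ}
    (h : ∀ n, ∀ a ∈ A, ∀ k, visitProb μ A n a (k + 1) ≤ C * ρ ^ k) (k m : ℕ) :
    seqLaw μ {e | ∃ a ∈ A, ∃ n, k + 1 ≤ visits A a (shift m e) n} ≤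
      A.card * ENNReal.ofReal (C * ρ ^ k) := by
  have h1 : {e : ℕ → E | ∃ a ∈ A, ∃ n, k + 1 ≤ visits A a (shift m e) n} =
      shift m ⁻¹' {e : ℕ → E | ∃ a ∈ A, ∃ n, k + 1 ≤ visits A a e n} := rfl
  rw [h1, ← Measure.map_apply (measurable_shift m) (measurableSet_exists_visits A _), map_shift]
  have h2 : {e : ℕ → E | ∃ a ∈ A, ∃ n, k + 1 ≤ visits A a e n} =
      ⋃ a ∈ A, ⋃ n, {e | k + 1 ≤ visits A a e n} := by
    ext e; simp
  rw [h2, ← nsmul_eq_mul]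
  refine (measure_biUnion_finset_le _ _).trans (Finset.sum_le_card_nsmul _ _ _ fun a ha => ?_)
  rw [Monotone.measure_iUnion]
  · refine iSup_le fun n => ?_
    rw [← ofReal_measureReal]
    exact ENNReal.ofReal_le_ofReal (h n a ha k)
  · intro i j hij e he
    simp only [Set.mem_ofPred_eq] at he ⊢
    exact he.trans (visits_mono_right _ _ _ hij)

theorem ae_eventually_visits_le {A : Finset E} {C ρ : ℝ} (hC : 0 ≤ C) (hρ0 : 0 < ρ) (hρ1 : ρ < 1)
    (h : ∀ n, ∀ a ∈ A, ∀ k, visitProb μ A n a (k + 1) ≤ C * ρ ^ k) {c : ℝ}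
    (hc : -1 / Real.log ρ < c) :
    ∀ᵐ e ∂seqLaw μ, ∀ᶠ n : ℕ in atTop, ∀ x, (visits A x e n : ℝ) ≤ c * Real.log n := by
  have hlog : Real.log ρ < 0 := Real.log_neg hρ0 hρ1
  obtain ⟨b, hb1, hb2⟩ := exists_between hc
  have hb0 : 0 < b := lt_trans (div_pos_of_neg_of_neg (by norm_num) hlog) hb1
  have hblog : b * Real.log ρ < -1 := by
    rw [div_lt_iff_of_neg hlog] at hb1; exact hb1
  -- The threshold depends on the entrance time `m`, not on the horizon `n`, so the exceptional
  -- events are summable over `m` without passing to a subsequence.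
  set κ : ℕ → ℕ := fun m => ⌈b * Real.log ((m + 2 : ℕ) : ℝ)⌉₊ with hκ
  have hpow : ∀ m : ℕ, ρ ^ κ m ≤ ((m + 2 : ℕ) : ℝ) ^ (b * Real.log ρ) := by
    intro m
    have hm : (0 : ℝ) < ((m + 2 : ℕ) : ℝ) := by positivity
    rw [← Real.rpow_natCast, Real.rpow_def_of_pos hρ0, Real.rpow_def_of_pos hm, Real.exp_le_exp]
    have := Nat.le_ceil (b * Real.log ((m + 2 : ℕ) : ℝ))
    calc Real.log ρ * (κ m : ℝ) ≤ Real.log ρ * (b * Real.log ((m + 2 : ℕ) : ℝ)) :=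
          mul_le_mul_of_nonpos_left this hlog.le
      _ = _ := by ring
  have hsum : Summable fun m => C * ρ ^ κ m := by
    refine Summable.mul_left C (Summable.of_nonneg_of_le (fun m => by positivity) hpow ?_)
    exact (summable_nat_add_iff (f := fun n : ℕ => (n : ℝ) ^ (b * Real.log ρ)) 2).2
      (Real.summable_nat_rpow.2 hblog)
  have hBC : ∀ᵐ e ∂seqLaw μ, ∀ᶠ m in atTop,
      e ∉ {e | ∃ a ∈ A, ∃ n, κ m + 1 ≤ visits A a (shift m e) n} := by
    refine ae_eventually_notMem (ne_top_of_le_ne_top ?_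
      (ENNReal.tsum_le_tsum fun m => measure_exists_visits_le μ h (κ m) m))
    rw [ENNReal.tsum_mul_left]
    refine ENNReal.mul_ne_top (ENNReal.natCast_ne_top _) ?_
    rw [← ENNReal.ofReal_tsum_of_nonneg (fun m => by positivity) hsum]
    exact ENNReal.ofReal_ne_top
  -- Needed for the finitely many `m` that Borel–Cantelli leaves out: each contributes a bound
  -- independent of `n`.
  have hfin : ∀ᵐ e ∂seqLaw μ, ∀ m, ∃ k : ℕ, ∀ a ∈ A, ∀ n, visits A a (shift m e) n ≤ k := by
    refine ae_all_iff.2 fun m => ?_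
    rw [ae_iff]
    refine le_antisymm (ge_of_tendsto' (x := atTop) (f := fun k : ℕ =>
      (A.card : ENNReal) * ENNReal.ofReal (C * ρ ^ k)) ?_ fun k => ?_) zero_le
    · have h1 : Tendsto (fun k : ℕ => ENNReal.ofReal (C * ρ ^ k)) atTop (𝓝 0) := by
        have h2 := (tendsto_pow_atTop_nhds_zero_of_lt_one hρ0.le hρ1).const_mul C
        rw [mul_zero] at h2
        simpa using ENNReal.tendsto_ofReal h2
      simpa using ENNReal.Tendsto.const_mul h1 (Or.inr (ENNReal.natCast_ne_top A.card))
    · refine (measure_mono fun e he => ?_).trans (measure_exists_visits_le μ h k m)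
      simp only [Set.mem_ofPred_eq] at he ⊢
      push Not at he
      obtain ⟨a, ha, n, hn⟩ := he k
      exact ⟨a, ha, n, hn⟩
  filter_upwards [hBC, hfin] with e h1 h2
  obtain ⟨M, hM⟩ := eventually_atTop.1 h1
  choose K hK using h2
  have hbound : ∀ n x, (visits A x e n : ℝ) ≤
      max ((∑ m ∈ Finset.range M, K m : ℕ) : ℝ) (b * Real.log ((n + 2 : ℕ) : ℝ) + 1) := by
    intro n x
    rcases visits_eq_zero_or_le (A : Set E) n x e with h0 | ⟨m, hm, a, ha, hle⟩
    · rw [h0]; exact le_max_of_le_left (Nat.cast_le.2 (Nat.zero_le _))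
    · rcases lt_or_ge m M with hmM | hmM
      · refine le_max_of_le_left (Nat.cast_le.2 (hle.trans ((hK m a ha n).trans ?_)))
        exact Finset.single_le_sum (f := K) (fun _ _ => Nat.zero_le _) (Finset.mem_range.2 hmM)
      · refine le_max_of_le_right ?_
        have h3 : visits A a (shift m e) n ≤ κ m := by
          by_contra h4
          exact hM m hmM ⟨a, ha, n, by omega⟩
        have h4 : (κ m : ℝ) < b * Real.log ((m + 2 : ℕ) : ℝ) + 1 :=
          Nat.ceil_lt_add_one (mul_nonneg hb0.le (Real.log_natCast_nonneg _))
        have h5 : Real.log ((m + 2 : ℕ) : ℝ) ≤ Real.log ((n + 2 : ℕ) : ℝ) :=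
          Real.log_le_log (by positivity) (Nat.cast_le.2 (by omega))
        have h6 : b * Real.log ((m + 2 : ℕ) : ℝ) ≤ b * Real.log ((n + 2 : ℕ) : ℝ) :=
          mul_le_mul_of_nonneg_left h5 hb0.le
        have h7 : (visits A x e n : ℝ) ≤ κ m := Nat.cast_le.2 (hle.trans h3)
        linarith
  have hlogtop : Tendsto (fun n : ℕ => Real.log n) atTop atTop :=
    Real.tendsto_log_atTop.comp tendsto_natCast_atTop_atTop
  have hc0 : 0 < c := hb0.trans hb2
  filter_upwards [(hlogtop.const_mul_atTop hc0).eventually_ge_atTop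
      ((∑ m ∈ Finset.range M, K m : ℕ) : ℝ),
    (hlogtop.const_mul_atTop (sub_pos.2 hb2)).eventually_ge_atTop (b * Real.log 2 + 1),
    eventually_ge_atTop 2] with n hn1 hn2 hn3 x
  refine (hbound n x).trans (max_le hn1 ?_)
  have hn0 : (0 : ℝ) < n := by positivity
  have h5 : Real.log ((n + 2 : ℕ) : ℝ) ≤ Real.log 2 + Real.log n := by
    rw [← Real.log_mul (by norm_num) hn0.ne']
    refine Real.log_le_log (by positivity) ?_
    have : (2 : ℝ) ≤ n := by exact_mod_cast hn3
    push_cast; linarith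
  have h6 := mul_le_mul_of_nonneg_left h5 hb0.le
  nlinarith

/-- Consecutive blocks share an endpoint in time but no increment, hence are independent. -/
lemma real_forall_block_visits_lt (A : Set E) (H k M : ℕ) :
    (seqLaw μ).real {e | ∀ i < M, visits A 0 (shift (i * H) e) H < k} =
      (1 - visitProb μ A H 0 k) ^ M := by
  have hmeas : ∀ M, MeasurableSet {e : ℕ → E | ∀ i < M, visits A 0 (shift (i * H) e) H < k} := by
    intro M
    have h : {e : ℕ → E | ∀ i < M, visits A 0 (shift (i * H) e) H < k} =
        ⋂ i, ⋂ (_ : i < M), shift (i * H) ⁻¹' {e | k ≤ visits A 0 e H}ᶜ := by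
      ext e; simp
    rw [h]
    exact MeasurableSet.iInter fun i => MeasurableSet.iInter fun _ =>
      measurable_shift _ (measurableSet_le_visits A H 0 k).compl
  induction M with
  | zero => simp
  | succ M ih =>
    have h1 : {e : ℕ → E | ∀ i < M + 1, visits A 0 (shift (i * H) e) H < k} =
        past (M * H) ⁻¹' {e | ∀ i < M, visits A 0 (shift (i * H) e) H < k} ∩
          shift (M * H) ⁻¹' {e | k ≤ visits A 0 e H}ᶜ := by
      ext e
      simp only [Set.mem_ofPred_eq, Set.mem_inter_iff, Set.mem_preimage, Set.mem_compl_iff, not_le,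
        Nat.forall_lt_succ_right]
      refine and_congr_left fun _ => forall₂_congr fun i hi => ?_
      have hle : i * H + H ≤ M * H := by
        rw [← Nat.succ_mul]; exact Nat.mul_le_mul_right H hi
      rw [← visits_past le_rfl, ← shift_past_of_le hle, visits_past le_rfl]
    have h2 : past (M * H) ⁻¹' {e : ℕ → E | ∀ i < M, visits A 0 (shift (i * H) e) H < k} =
        {e | ∀ i < M, visits A 0 (shift (i * H) e) H < k} := by
      ext e
      simp only [Set.mem_ofPred_eq, Set.mem_preimage]
      refine forall₂_congr fun i hi => ?_
      have hle : i * H + H ≤ M * H := by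
        rw [← Nat.succ_mul]; exact Nat.mul_le_mul_right H hi
      rw [← visits_past le_rfl, shift_past_of_le hle, visits_past le_rfl]
    rw [h1, real_past_inter_shift μ _ (hmeas M) (measurableSet_le_visits A H 0 k).compl, h2, ih,
      probReal_compl_eq_one_sub (measurableSet_le_visits A H 0 k), pow_succ]
    rfl

theorem ae_eventually_le_visits {A : Set E} {ρ : ℝ} (hρ0 : 0 < ρ) (hρ1 : ρ < 1)
    (h : ∀ r, 0 < r → r < ρ → ∃ b > 0, ∃ T s : ℕ, ∀ k,
      b * r ^ k ≤ visitProb μ A (k * T + s) 0 (k + 1)) {c : ℝ} (hc0 : 0 < c)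
    (hc : c < -1 / Real.log ρ) :
    ∀ᵐ e ∂seqLaw μ, ∀ᶠ n : ℕ in atTop, ∃ m ≤ n,
      c * Real.log n ≤ visits A 0 (shift m e) (n - m) := by
  have hlog : Real.log ρ < 0 := Real.log_neg hρ0 hρ1
  have hθ : 1 / ρ < Real.exp (1 / c) := by
    rw [← Real.exp_log (one_div_pos.2 hρ0), Real.exp_lt_exp, one_div, Real.log_inv,
      lt_div_iff₀ hc0]
    rw [lt_div_iff_of_neg hlog] at hc
    linarith
  -- `t ^ k` is the number of blocks: `t < exp (1 / c)` makes them fit, and `t > 1 / ρ` leaves room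
  -- for `r < ρ` with `r * t > 1`, so the expected number of successes grows geometrically.
  obtain ⟨t, ht1, ht2⟩ := exists_between hθ
  have ht0 : 0 < t := (one_div_pos.2 hρ0).trans ht1
  have hrt : 1 / t < ρ := by rwa [one_div_lt ht0 hρ0]
  obtain ⟨r, hr1, hr2⟩ := exists_between hrt
  have hr0 : 0 < r := (one_div_pos.2 ht0).trans hr1
  have hrt1 : 1 < r * t := by rwa [div_lt_iff₀ ht0] at hr1
  obtain ⟨b, hb, T, s, hT⟩ := h r hr0 hr2
  set H : ℕ → ℕ := fun k => k * T + s with hH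
  set M : ℕ → ℕ := fun k => ⌈t ^ k⌉₊ with hM
  have hprob : ∀ k, (seqLaw μ).real
      {e | ∀ i < M k, visits A 0 (shift (i * H k) e) (H k) < k + 1} ≤ b⁻¹ * ((r * t)⁻¹) ^ k := by
    intro k
    rw [real_forall_block_visits_lt]
    set p := visitProb μ A (H k) 0 (k + 1) with hp
    have hp1 : p ≤ 1 := visitProb_le_one μ _ _ _ _
    have hpM : b * (r * t) ^ k ≤ p * M k := by
      rw [mul_pow, ← mul_assoc]
      exact mul_le_mul (hT k) (Nat.le_ceil _) (by positivity) (visitProb_nonneg μ _ _ _ _)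
    have hpos : 0 < b * (r * t) ^ k := by positivity
    calc (1 - p) ^ M k ≤ Real.exp (-p) ^ M k :=
          pow_le_pow_left₀ (by linarith) (Real.one_sub_le_exp_neg p) _
      _ = (Real.exp (p * M k))⁻¹ := by
          rw [← Real.exp_nat_mul, ← Real.exp_neg]; congr 1; ring
      _ ≤ (b * (r * t) ^ k)⁻¹ := by
          refine inv_anti₀ hpos (hpM.trans ?_)
          linarith [Real.add_one_le_exp (p * M k)]
      _ = _ := by rw [mul_inv, inv_pow]
  have hsum : Summable fun k : ℕ => b⁻¹ * ((r * t)⁻¹) ^ k :=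
    (summable_geometric_of_lt_one (by positivity) (inv_lt_one_of_one_lt₀ hrt1)).mul_left _
  have hBC : ∀ᵐ e ∂seqLaw μ, ∀ᶠ k in atTop,
      e ∉ {e | ∀ i < M k, visits A 0 (shift (i * H k) e) (H k) < k + 1} := by
    refine ae_eventually_notMem (ne_top_of_le_ne_top ?_ (ENNReal.tsum_le_tsum fun k =>
      (ofReal_measureReal (μ := seqLaw μ)).symm.le.trans (ENNReal.ofReal_le_ofReal (hprob k))))
    rw [← ENNReal.ofReal_tsum_of_nonneg (fun k => by positivity) hsum]
    exact ENNReal.ofReal_ne_top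
  have hlen : ∀ᶠ k : ℕ in atTop, ((M k * H k : ℕ) : ℝ) ≤ Real.exp (1 / c) ^ k := by
    set q := t / Real.exp (1 / c) with hq
    have hq0 : 0 < q := by positivity
    have hq1 : q < 1 := (div_lt_one (Real.exp_pos _)).2 ht2
    have h1 : Tendsto (fun k : ℕ => 2 * T * (k * q ^ k) + 2 * s * q ^ k) atTop (𝓝 0) := by
      simpa using ((tendsto_self_mul_const_pow_of_lt_one hq0.le hq1).const_mul (2 * (T : ℝ))).add
        ((tendsto_pow_atTop_nhds_zero_of_lt_one hq0.le hq1).const_mul (2 * (s : ℝ)))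
    have ht1' : 1 < t := lt_trans (by rw [lt_div_iff₀ hρ0]; linarith) ht1
    filter_upwards [h1.eventually_le_const one_pos] with k hk
    have hk1 : 1 ≤ t ^ k := one_le_pow₀ ht1'.le
    have hMk : (M k : ℝ) ≤ 2 * t ^ k := by
      have := Nat.ceil_lt_add_one (zero_le_one.trans hk1)
      linarith
    have hqk : t ^ k = q ^ k * Real.exp (1 / c) ^ k := by
      rw [← mul_pow, hq, div_mul_cancel₀ _ (Real.exp_pos _).ne']
    calc ((M k * H k : ℕ) : ℝ) = M k * (k * T + s) := by rw [hH]; push_cast; ring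
      _ ≤ 2 * t ^ k * (k * T + s) := by gcongr
      _ = (2 * T * (k * q ^ k) + 2 * s * q ^ k) * Real.exp (1 / c) ^ k := by rw [hqk]; ring
      _ ≤ 1 * Real.exp (1 / c) ^ k := by gcongr
      _ = _ := one_mul _
  have hlogtop : Tendsto (fun n : ℕ => c * Real.log n) atTop atTop :=
    (Real.tendsto_log_atTop.comp tendsto_natCast_atTop_atTop).const_mul_atTop hc0
  have hktop : Tendsto (fun n : ℕ => ⌊c * Real.log n⌋₊) atTop atTop :=
    tendsto_nat_floor_atTop.comp hlogtop
  filter_upwards [hBC] with e he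
  filter_upwards [hktop.eventually he, hktop.eventually hlen, eventually_ge_atTop 1]
    with n hn1 hn2 hn3
  -- Then `exp (1 / c) ^ k ≤ n`, so all blocks end by time `n`, and `k + 1` visits exceed `c * log
  -- n`.
  set k := ⌊c * Real.log n⌋₊ with hk
  obtain ⟨i, hi, hvis⟩ : ∃ i < M k, k + 1 ≤ visits A 0 (shift (i * H k) e) (H k) := by
    by_contra hcon
    push Not at hcon
    exact hn1 hcon
  have hlog0 : 0 ≤ c * Real.log n := mul_nonneg hc0.le (Real.log_natCast_nonneg _)
  have hθn : Real.exp (1 / c) ^ k ≤ n := by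
    rw [← Real.exp_nat_mul, ← Real.le_log_iff_exp_le (by positivity), mul_one_div,
      div_le_iff₀ hc0, mul_comm]
    exact Nat.floor_le hlog0
  have hle : i * H k + H k ≤ n := by
    have h1 : i * H k + H k ≤ M k * H k := by
      rw [← Nat.succ_mul]; exact Nat.mul_le_mul_right _ hi
    exact h1.trans (Nat.cast_le.1 (hn2.trans hθn))
  refine ⟨i * H k, by omega, ?_⟩
  have h1 : k + 1 ≤ visits A 0 (shift (i * H k) e) (n - i * H k) :=
    hvis.trans (visits_mono_right _ _ _ (by omega))
  have h2 : c * Real.log n < k + 1 := Nat.lt_floor_add_one _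
  have h3 : ((k + 1 : ℕ) : ℝ) ≤ visits A 0 (shift (i * H k) e) (n - i * H k) := Nat.cast_le.2 h1
  push_cast at h3
  linarith

end AlmostSure

end

end LatticeWalk

namespace LatticeWalk

noncomputable section

set_option linter.unusedSectionVars false

/-! ### The Green matrix and the constants in the visit bounds. -/

section Spectral

variable {E : Type*} [AddCommGroup E] [Countable E] [MeasurableSpace E] [DiscreteMeasurableSpace E]
  (μ : Measure E) [IsProbabilityMeasure μ]

lemma ae_singleton_pos : ∀ᵐ z ∂μ, 0 < μ.real {z} := by
  rw [ae_iff, ← Set.biUnion_of_singleton {z | ¬0 < μ.real {z}},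
    measure_biUnion_null_iff (Set.to_countable _)]
  intro z hz
  rw [Set.mem_ofPred_eq, not_lt] at hz
  exact (measureReal_eq_zero_iff).1 (le_antisymm hz measureReal_nonneg)

lemma heat_two_zero_pos (hμ : μ.map (fun z => -z) = μ) : 0 < heat μ 2 0 := by
  obtain ⟨z, hz⟩ := (ae_singleton_pos μ).exists
  have h1 : 0 < heat μ 1 z := by
    refine lt_of_lt_of_le ?_ (mul_heat_le_heat_succ μ 0 z z)
    rwa [sub_self, heat_zero_self, mul_one]
  have h2 := heat_mul_heat_le μ 1 1 z (-z)
  rw [heat_neg μ hμ, add_neg_cancel] at h2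
  exact (mul_pos h1 h1).trans_le h2

/-- The Green matrix of the walk with step law `μ` on a finite set. -/
def potentialMatrix (A : Finset E) : Matrix A A ℝ :=
  Matrix.of fun x y => ∑' k, heat μ k (x.1 - y.1)

variable {μ}

/-- A positive eigenvector of the Green matrix for its largest eigenvalue, in terms of the
truncated potentials. -/
lemma exists_pos_tendsto_potential [DecidableEq E] (hμ : μ.map (fun z => -z) = μ)
    (hgen : AddSubgroup.closure {z : E | 0 < μ.real {z}} = ⊤)
    (htrans : ∀ᵐ e ∂seqLaw μ, {n | walk e n = 0}.Finite)
    {A : Finset E} (hA : A.Nonempty) :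
    ∃ v : E → ℝ, (∀ x ∈ A, 0 < v x) ∧ ∀ x ∈ A, Tendsto (fun n => potential μ A v n x) atTop
      (𝓝 (largestEigenvalue (potentialMatrix μ A) * v x)) := by
  have hs := summable_heat μ hμ hgen htrans
  have : Nonempty A := hA.to_subtype
  have hsym : (potentialMatrix μ A).IsSymm := by
    refine Matrix.IsSymm.ext fun i j => ?_
    simp only [potentialMatrix, Matrix.of_apply]
    refine tsum_congr fun k => ?_
    rw [← heat_neg μ hμ, neg_sub]
  have hpos : ∀ i j, 0 < potentialMatrix μ A i j := by
    intro i j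
    obtain ⟨k, hk⟩ := exists_heat_pos μ hμ hgen (i.1 - j.1)
    exact (hs _).tsum_pos (fun _ => heat_nonneg μ _ _) k hk
  obtain ⟨v, hv, hMv⟩ := exists_pos_eigenvector hsym hpos
  set w : E → ℝ := fun x => if h : x ∈ A then v ⟨x, h⟩ else 0 with hw
  have hwv : ∀ x : A, w x = v x := fun x => by simp [hw]
  refine ⟨w, fun x hx => by rw [hwv ⟨x, hx⟩]; exact hv _, fun x hx => ?_⟩
  have hsum : HasSum (fun j => ∑ y ∈ A, w y * heat μ j (y - x))
      (∑ y ∈ A, w y * ∑' j, heat μ j (y - x)) :=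
    hasSum_sum fun y _ => (hs (y - x)).hasSum.mul_left (w y)
  have heq : ∑ y ∈ A, w y * ∑' j, heat μ j (y - x) =
      largestEigenvalue (potentialMatrix μ A) * w x := by
    have h1 := congrFun hMv ⟨x, hx⟩
    rw [Pi.smul_apply, smul_eq_mul, ← hwv ⟨x, hx⟩] at h1
    rw [← h1, Matrix.mulVec, dotProduct, ← Finset.sum_coe_sort]
    refine Finset.sum_congr rfl fun y _ => ?_
    rw [hwv, mul_comm]
    congr 1
    refine tsum_congr fun k => ?_
    rw [← heat_neg μ hμ, neg_sub]
  rw [heq] at hsum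
  -- `potential` at `n` includes time `n`, so it is the partial sum with `n + 1` terms.
  exact hsum.tendsto_sum_nat.comp (tendsto_add_atTop_nat 1)

variable {A : Finset E} {v : E → ℝ} {L : ℝ}

lemma potential_le_of_tendsto (hv : ∀ x ∈ A, 0 < v x)
    (hlim : ∀ x ∈ A, Tendsto (fun n => potential μ A v n x) atTop (𝓝 (L * v x)))
    (n : ℕ) (x : E) (hx : x ∈ A) : potential μ A v n x ≤ L * v x :=
  (potential_mono μ hv x).ge_of_tendsto (hlim x hx) n

/-- The visit at time `0` contributes `v x`, and a possible step followed by its reverse adds a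
positive amount at time `2`. This puts `1 - 1 / L` strictly between `0` and `1`. -/
lemma one_lt_of_tendsto_potential (hμ : μ.map (fun z => -z) = μ) (hA : A.Nonempty)
    (hv : ∀ x ∈ A, 0 < v x)
    (hlim : ∀ x ∈ A, Tendsto (fun n => potential μ A v n x) atTop (𝓝 (L * v x))) : 1 < L := by
  obtain ⟨x, hx⟩ := hA
  have h1 := potential_le_of_tendsto hv hlim 2 x hx
  have h2 : ∑ j ∈ Finset.range 3, v x * heat μ j 0 ≤ potential μ A v 2 x := by
    refine Finset.sum_le_sum fun j _ => ?_
    have := Finset.single_le_sum (f := fun y => v y * heat μ j (y - x))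
      (fun y hy => mul_nonneg (hv y hy).le (heat_nonneg μ _ _)) hx
    simpa using this
  simp only [Finset.sum_range_succ, Finset.sum_range_zero, heat_zero_self] at h2
  have h3 := mul_pos (hv x hx) (heat_two_zero_pos μ hμ)
  have h4 := mul_nonneg (hv x hx).le (heat_nonneg μ 1 0)
  have h5 : 1 * v x < L * v x := by linarith
  exact lt_of_mul_lt_mul_right h5 (hv x hx).le

lemma exists_visitProb_le (hv : ∀ x ∈ A, 0 < v x) (hL : 1 < L)
    (hlim : ∀ x ∈ A, Tendsto (fun n => potential μ A v n x) atTop (𝓝 (L * v x))) :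
    ∃ C, 0 ≤ C ∧ ∀ n, ∀ a ∈ A, ∀ k, visitProb μ A n a (k + 1) ≤ C * (1 - 1 / L) ^ k := by
  have hr : 0 ≤ 1 - 1 / L := by
    rw [sub_nonneg, div_le_one (by linarith)]; exact hL.le
  set C := ∑ x ∈ A, (v x)⁻¹ with hC
  have hC0 : 0 ≤ C := Finset.sum_nonneg fun x hx => (inv_pos.2 (hv x hx)).le
  have hV0 : 0 ≤ ∑ x ∈ A, v x := Finset.sum_nonneg fun x hx => (hv x hx).le
  have hCv : ∀ x ∈ A, 1 ≤ C * v x := by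
    intro x hx
    rw [← inv_mul_cancel₀ (hv x hx).ne']
    exact mul_le_mul_of_nonneg_right (Finset.single_le_sum (f := fun x => (v x)⁻¹)
      (fun y hy => (inv_pos.2 (hv y hy)).le) hx) (hv x hx).le
  refine ⟨C * (L * ∑ x ∈ A, v x), by positivity, fun n a ha k => ?_⟩
  have hle := potential_le_of_tendsto hv hlim
  refine (visitProb_le μ hv hL hle hC0 hCv n a k).trans ?_
  have h1 : potential μ A v n a ≤ L * ∑ x ∈ A, v x :=
    (hle n a ha).trans (mul_le_mul_of_nonneg_left
      (Finset.single_le_sum (f := v) (fun y hy => (hv y hy).le) ha) (by linarith))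
  calc C * (1 - 1 / L) ^ k * potential μ A v n a
      ≤ C * (1 - 1 / L) ^ k * (L * ∑ x ∈ A, v x) := by gcongr
    _ = _ := by ring

/-- The blocks start at `0`, which need not lie in `A`; reaching some `a ∈ A` at a fixed time `s`
costs only the constant `b`. -/
lemma exists_le_visitProb (hμ : μ.map (fun z => -z) = μ)
    (hgen : AddSubgroup.closure {z : E | 0 < μ.real {z}} = ⊤) (hA : A.Nonempty)
    (hv : ∀ x ∈ A, 0 < v x) (hL : 1 < L)
    (hlim : ∀ x ∈ A, Tendsto (fun n => potential μ A v n x) atTop (𝓝 (L * v x)))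
    {r : ℝ} (hr0 : 0 < r) (hr : r < 1 - 1 / L) :
    ∃ b > 0, ∃ T s : ℕ, ∀ k, b * r ^ k ≤ visitProb μ A (k * T + s) 0 (k + 1) := by
  have hL0 : 0 < L := by linarith
  have hev : ∀ᶠ n in atTop, ∀ x ∈ A, r * (L * v x) ≤ potential μ A v n x - v x := by
    refine (Finset.eventually_all A).2 fun x hx => ?_
    have h1 : r * (L * v x) + v x < L * v x := by
      have h2 := mul_lt_mul_of_pos_right hr (mul_pos hL0 (hv x hx))
      have h3 : (1 - 1 / L) * (L * v x) = L * v x - v x := by field_simp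
      linarith
    filter_upwards [(hlim x hx).eventually_const_le h1] with n hn
    linarith
  obtain ⟨T, hT⟩ := eventually_atTop.1 hev
  obtain ⟨a, ha⟩ := hA
  obtain ⟨s, hs⟩ := exists_heat_pos μ hμ hgen a
  have hpot : 0 < potential μ A v s 0 := by
    refine lt_of_lt_of_le (mul_pos (hv a ha) hs) ?_
    have h1 : v a * heat μ s a ≤ ∑ y ∈ A, v y * heat μ s (y - 0) := by
      simpa using Finset.single_le_sum (f := fun y => v y * heat μ s (y - 0))
        (fun y hy => mul_nonneg (hv y hy).le (heat_nonneg μ _ _)) ha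
    exact h1.trans (Finset.single_le_sum (f := fun j => ∑ y ∈ A, v y * heat μ j (y - 0))
      (fun j _ => Finset.sum_nonneg fun y hy => mul_nonneg (hv y hy).le (heat_nonneg μ _ _))
      (Finset.mem_range.2 (Nat.lt_succ_self s)))
  have hV : 0 < ∑ x ∈ A, v x := Finset.sum_pos hv ⟨a, ha⟩
  set c := (L * ∑ x ∈ A, v x)⁻¹ with hc
  have hc0 : 0 < c := by positivity
  have hcL : ∀ x ∈ A, c * (L * v x) ≤ 1 := by
    intro x hx
    rw [hc, inv_mul_le_iff₀ (by positivity), mul_one]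
    exact mul_le_mul_of_nonneg_left
      (Finset.single_le_sum (f := v) (fun y hy => (hv y hy).le) hx) hL0.le
  refine ⟨c * potential μ A v s 0, by positivity, T + 1, s, fun k => ?_⟩
  have := le_visitProb μ hr0.le hc0.le (potential_le_of_tendsto hv hlim) hcL
    (fun n hn => hT n hn.le) k s 0
  calc c * potential μ A v s 0 * r ^ k = c * r ^ k * potential μ A v s 0 := by ring
    _ ≤ _ := this

end Spectral

/-! ### Transfer from `X` to its increment sequence. -/

section Transfer

variable {d : ℕ} {Ω : Type*} [MeasurableSpace Ω] {P : Measure Ω} [IsProbabilityMeasure P]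
  {X : ℕ → Ω → (Fin d → ℤ)}

/-- The increments of a path. -/
def increments (X : ℕ → Ω → (Fin d → ℤ)) (ω : Ω) : ℕ → (Fin d → ℤ) :=
  fun n => X (n + 1) ω - X n ω

/-- The law of the first increment. -/
def stepLaw (P : Measure Ω) (X : ℕ → Ω → (Fin d → ℤ)) : Measure (Fin d → ℤ) :=
  P.map fun ω => X 1 ω - X 0 ω

lemma IsRandomWalk.measurable_increment (hX : IsRandomWalk P X) (n : ℕ) :
    Measurable fun ω => X (n + 1) ω - X n ω :=
  (hX.measurable (n + 1)).sub (hX.measurable n)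

lemma IsRandomWalk.measurable_increments (hX : IsRandomWalk P X) :
    Measurable (increments X) :=
  measurable_pi_lambda _ hX.measurable_increment

lemma IsRandomWalk.isProbabilityMeasure_stepLaw (hX : IsRandomWalk P X) :
    IsProbabilityMeasure (stepLaw P X) :=
  Measure.isProbabilityMeasure_map (hX.measurable_increment 0).aemeasurable

lemma IsRandomWalk.map_increments (hX : IsRandomWalk P X) :
    P.map (increments X) = seqLaw (stepLaw P X) := by
  have h := hX.indep.map_fun_eq_infinitePi_map hX.measurable_increment
  simp only [fun n => (hX.identDistrib n).map_eq] at h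
  exact h

lemma IsRandomWalk.ae_eq_walk (hX : IsRandomWalk P X) :
    ∀ᵐ ω ∂P, ∀ n, X n ω = walk (increments X ω) n := by
  filter_upwards [hX.start] with ω h0 n
  rw [walk]
  simp only [increments]
  rw [Finset.sum_range_sub (fun n => X n ω), h0, sub_zero]

lemma IsRandomWalk.heat_stepLaw (hX : IsRandomWalk P X) [IsProbabilityMeasure (stepLaw P X)]
    (j : ℕ) (x : Fin d → ℤ) : heat (stepLaw P X) j x = P.real {ω | X j ω = x} := by
  rw [heat, ← hX.map_increments,
    map_measureReal_apply hX.measurable_increments (measurableSet_walk_eq j x)]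
  refine measureReal_congr ?_
  filter_upwards [hX.ae_eq_walk] with ω h
  change (walk (increments X ω) j = x) = (X j ω = x)
  rw [h]

lemma IsRandomWalk.potentialMatrix_stepLaw (hX : IsRandomWalk P X)
    [IsProbabilityMeasure (stepLaw P X)] (A : Finset (Fin d → ℤ)) :
    potentialMatrix (stepLaw P X) A = greenMatrix P X A := by
  ext x y
  simp only [potentialMatrix, greenMatrix, green, Matrix.of_apply, hX.heat_stepLaw]

lemma IsRandomWalk.map_neg_stepLaw (hX : IsRandomWalk P X) (hsymm : IsSymmetricWalk P X) :
    (stepLaw P X).map (fun z => -z) = stepLaw P X := by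
  have h : stepLaw P X = P.map (X 1) := by
    refine Measure.map_congr ?_
    filter_upwards [hX.start] with ω h0
    rw [h0, sub_zero]
  rw [h, Measure.map_map Measurable.of_discrete (hX.measurable 1)]
  exact hsymm.map_eq.symm

/-- Almost surely every increment is an atom of the step law, so the whole path stays in the
subgroup generated by the atoms. -/
lemma IsRandomWalk.closure_stepLaw_support (hX : IsRandomWalk P X)
    (hfull : NotSupportedOnProperSubgroup P X) :
    AddSubgroup.closure {z | 0 < (stepLaw P X).real {z}} = ⊤ := by
  have := hX.isProbabilityMeasure_stepLaw
  refine hfull _ ?_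
  have h : ∀ᵐ ω ∂P, ∀ n, 0 < (stepLaw P X).real {increments X ω n} := by
    refine ae_all_iff.2 fun n => ?_
    have h1 := ae_singleton_pos (stepLaw P X)
    rw [stepLaw, ← (hX.identDistrib n).map_eq] at h1
    have h2 := ae_of_ae_map (hX.measurable_increment n).aemeasurable h1
    rw [(hX.identDistrib n).map_eq] at h2
    exact h2
  filter_upwards [hX.ae_eq_walk, h] with ω h1 h2 n
  rw [h1]
  exact AddSubgroup.sum_mem _ fun i _ => AddSubgroup.subset_closure (h2 i)

lemma IsRandomWalk.ae_finite_stepLaw (hX : IsRandomWalk P X) (htrans : IsTransient P X)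
    [IsProbabilityMeasure (stepLaw P X)] :
    ∀ᵐ e ∂seqLaw (stepLaw P X), {n | walk e n = 0}.Finite := by
  have hiff : ∀ e : ℕ → Fin d → ℤ, {n | walk e n = 0}.Finite ↔ ∃ N, ∀ n, N < n → walk e n ≠ 0 := by
    intro e
    rw [Set.finite_iff_bddAbove, bddAbove_def]
    refine exists_congr fun N => ⟨fun h n hn h0 => ?_, fun h n hn => ?_⟩
    · exact absurd (h n h0) (by omega)
    · by_contra hN
      exact h n (by omega) hn
  have hmeas : MeasurableSet {e : ℕ → Fin d → ℤ | {n | walk e n = 0}.Finite} := by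
    have h : {e : ℕ → Fin d → ℤ | {n | walk e n = 0}.Finite} =
        ⋃ N, ⋂ n, ⋂ (_ : N < n), {e | walk e n = 0}ᶜ := by
      ext e
      simp [hiff]
    rw [h]
    exact MeasurableSet.iUnion fun N => MeasurableSet.iInter fun n => MeasurableSet.iInter fun _ =>
      (measurableSet_walk_eq n 0).compl
  rw [← hX.map_increments, ae_map_iff hX.measurable_increments.aemeasurable hmeas]
  filter_upwards [htrans, hX.ae_eq_walk] with ω h1 h2
  simpa only [h2] using h1

lemma occupation_eq_visits {ω : Ω} {e : ℕ → Fin d → ℤ} (h : ∀ n, X n ω = walk e n) (n : ℕ)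
    (x : Fin d → ℤ) (A : Set (Fin d → ℤ)) :
    occupation X n (x +ᵥ A) ω = visits A (-x) e n := by
  classical
  simp only [occupation, visits, Nat.cast_sum, h]
  refine Finset.sum_congr rfl fun j _ => ?_
  simp only [Set.indicator_apply, Set.mem_vadd_set_iff_neg_vadd_mem, vadd_eq_add, Pi.one_apply]
  split_ifs <;> simp

/-- Recentre the walk at its position at time `m` and discard the visits made before `m`. -/
lemma visits_shift_le {E : Type*} [AddCommGroup E] (A : Set E) (e : ℕ → E) {m n : ℕ}
    (h : m ≤ n) : visits A 0 (shift m e) (n - m) ≤ visits A (-walk e m) e n := by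
  have hn : n + 1 = m + (n - m + 1) := by omega
  rw [visits, visits, hn, Finset.sum_range_add _ m]
  refine le_trans (le_of_eq (Finset.sum_congr rfl fun j _ => ?_)) (Nat.le_add_left _ _)
  rw [walk_add, neg_add_cancel_left, zero_add]

end Transfer

/-- Rational levels suffice, so the exceptional null sets form a countable family. The floor `b`
restricts lower bounds to levels above it, here the positive ones. -/
lemma ae_tendsto_of_forall_ae_eventually {Ω : Type*} [MeasurableSpace Ω] {P : Measure Ω}
    {f : ℕ → Ω → ℝ} {l b : ℝ} (hb : b < l)
    (hupper : ∀ c, l < c → ∀ᵐ ω ∂P, ∀ᶠ n in atTop, f n ω ≤ c)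
    (hlower : ∀ c, b < c → c < l → ∀ᵐ ω ∂P, ∀ᶠ n in atTop, c ≤ f n ω) :
    ∀ᵐ ω ∂P, Tendsto (fun n => f n ω) atTop (𝓝 l) := by
  have h1 : ∀ᵐ ω ∂P, ∀ q : ℚ, l < q → ∀ᶠ n in atTop, f n ω ≤ q :=
    ae_all_iff.2 fun q => eventually_imp_distrib_left.2 fun hq => hupper q hq
  have h2 : ∀ᵐ ω ∂P, ∀ q : ℚ, b < q → (q : ℝ) < l → ∀ᶠ n in atTop, (q : ℝ) ≤ f n ω :=
    ae_all_iff.2 fun q => eventually_imp_distrib_left.2 fun hq =>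
      eventually_imp_distrib_left.2 fun hq' => hlower q hq hq'
  filter_upwards [h1, h2] with ω h1 h2
  refine tendsto_order.2 ⟨fun a ha => ?_, fun a ha => ?_⟩
  · obtain ⟨q, hq1, hq2⟩ := exists_rat_btwn (max_lt ha hb)
    filter_upwards [h2 q ((le_max_right _ _).trans_lt hq1) hq2] with n hn
    exact ((le_max_left _ _).trans_lt hq1).trans_le hn
  · obtain ⟨q, hq1, hq2⟩ := exists_rat_btwn ha
    filter_upwards [h1 q hq1] with n hn
    exact hn.trans_lt hq2

end

end LatticeWalk

/-! ### The two limits. -/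

theorem theorem1p1 {d : ℕ} (hd : 3 ≤ d) {Ω : Type*} [MeasurableSpace Ω]
    (P : Measure Ω) [IsProbabilityMeasure P] (X : ℕ → Ω → (Fin d → ℤ))
    (hX : LatticeWalk.IsRandomWalk P X)
    (hsymm : LatticeWalk.IsSymmetricWalk P X)
    (htrans : LatticeWalk.IsTransient P X)
    (hfull : LatticeWalk.NotSupportedOnProperSubgroup P X)
    (hmom : LatticeWalk.HasFiniteSecondMoments P X)
    (A : Finset (Fin d → ℤ)) (hA : A.Nonempty) :
    (∀ᵐ ω ∂P, Tendsto
      (fun n : ℕ => ⨆ x : Fin d → ℤ,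
        LatticeWalk.occupation X n (x +ᵥ (A : Set (Fin d → ℤ))) ω / Real.log n)
      atTop
      (𝓝 (-1 / Real.log
        (1 - 1 / LatticeWalk.largestEigenvalue (LatticeWalk.greenMatrix P X A))))) ∧
    (∀ᵐ ω ∂P, Tendsto
      (fun n : ℕ => ⨆ m : Fin (n + 1),
        LatticeWalk.occupation X n (X m ω +ᵥ (A : Set (Fin d → ℤ))) ω / Real.log n)
      atTop
      (𝓝 (-1 / Real.log
        (1 - 1 / LatticeWalk.largestEigenvalue (LatticeWalk.greenMatrix P X A))))) := by
  have hprob := hX.isProbabilityMeasure_stepLaw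
  have hμ := hX.map_neg_stepLaw hsymm
  have hgen := hX.closure_stepLaw_support hfull
  obtain ⟨v, hv, hlim⟩ :=
    LatticeWalk.exists_pos_tendsto_potential hμ hgen (hX.ae_finite_stepLaw htrans) hA
  rw [hX.potentialMatrix_stepLaw] at hlim
  set L := LatticeWalk.largestEigenvalue (LatticeWalk.greenMatrix P X A) with hLdef
  have hL : 1 < L := LatticeWalk.one_lt_of_tendsto_potential hμ hA hv hlim
  have hinv : 0 < 1 / L ∧ 1 / L < 1 :=
    ⟨by positivity, by rw [div_lt_one (by linarith)]; exact hL⟩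
  have hρ0 : 0 < 1 - 1 / L := by linarith [hinv.2]
  have hρ1 : 1 - 1 / L < 1 := by linarith [hinv.1]
  have hl : 0 < -1 / Real.log (1 - 1 / L) :=
    div_pos_of_neg_of_neg (by norm_num) (Real.log_neg hρ0 hρ1)
  obtain ⟨C, hC, hCle⟩ := LatticeWalk.exists_visitProb_le hv hL hlim
  have hupper : ∀ c, -1 / Real.log (1 - 1 / L) < c → ∀ᵐ ω ∂P, ∀ᶠ n : ℕ in atTop,
      ∀ x : Fin d → ℤ,
      LatticeWalk.occupation X n (x +ᵥ (A : Set (Fin d → ℤ))) ω / Real.log n ≤ c := by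
    intro c hc
    have h := LatticeWalk.ae_eventually_visits_le _ hC hρ0 hρ1 hCle hc
    rw [← hX.map_increments] at h
    filter_upwards [hX.ae_eq_walk, ae_of_ae_map hX.measurable_increments.aemeasurable h]
      with ω hω h1
    filter_upwards [h1, eventually_ge_atTop 2] with n hn hn2 x
    have hlog : 0 < Real.log n := Real.log_pos (by exact_mod_cast hn2)
    rw [LatticeWalk.occupation_eq_visits hω, div_le_iff₀ hlog]
    exact hn (-x)
  have hlower : ∀ c, 0 < c → c < -1 / Real.log (1 - 1 / L) → ∀ᵐ ω ∂P, ∀ᶠ n : ℕ in atTop,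
      ∃ m : Fin (n + 1),
        c ≤ LatticeWalk.occupation X n (X m ω +ᵥ (A : Set (Fin d → ℤ))) ω / Real.log n := by
    intro c hc0 hc
    have h := LatticeWalk.ae_eventually_le_visits (LatticeWalk.stepLaw P X)
      (A := (A : Set (Fin d → ℤ))) hρ0 hρ1
      (fun r hr0 hr => LatticeWalk.exists_le_visitProb hμ hgen hA hv hL hlim hr0 hr) hc0 hc
    rw [← hX.map_increments] at h
    filter_upwards [hX.ae_eq_walk, ae_of_ae_map hX.measurable_increments.aemeasurable h]
      with ω hω h1
    filter_upwards [h1, eventually_ge_atTop 2] with n hn hn2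
    obtain ⟨m, hm, hle⟩ := hn
    have hlog : 0 < Real.log n := Real.log_pos (by exact_mod_cast hn2)
    refine ⟨⟨m, Nat.lt_succ_of_le hm⟩, ?_⟩
    rw [LatticeWalk.occupation_eq_visits hω, le_div_iff₀ hlog, hω]
    exact hle.trans (Nat.cast_le.2 (LatticeWalk.visits_shift_le _ _ hm))
  constructor
  · refine LatticeWalk.ae_tendsto_of_forall_ae_eventually hl (fun c hc => ?_) fun c hc0 hc => ?_
    · filter_upwards [hupper c hc] with ω h
      filter_upwards [h] with n hn
      exact ciSup_le hn
    -- The supremum runs over an infinite set, and a real `⨆` of an unbounded family is `0`; the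
    -- upper bound at level limit plus one supplies boundedness.
    · filter_upwards [hlower c hc0 hc, hupper _ (lt_add_one _)] with ω h1 h2
      filter_upwards [h1, h2] with n ⟨m, hm⟩ hn
      exact hm.trans (le_ciSup (f := fun x : Fin d → ℤ =>
        LatticeWalk.occupation X n (x +ᵥ (A : Set (Fin d → ℤ))) ω / Real.log n)
        ⟨_, Set.forall_mem_range.2 hn⟩ (X m ω))
  · refine LatticeWalk.ae_tendsto_of_forall_ae_eventually hl (fun c hc => ?_) fun c hc0 hc => ?_
    · filter_upwards [hupper c hc] with ω h
      filter_upwards [h] with n hn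
      exact ciSup_le fun m => hn _
    · filter_upwards [hlower c hc0 hc] with ω h1
      filter_upwards [h1] with n ⟨m, hm⟩
      exact hm.trans (le_ciSup (f := fun m : Fin (n + 1) =>
        LatticeWalk.occupation X n (X m ω +ᵥ (A : Set (Fin d → ℤ))) ω / Real.log n)
        (Set.finite_range _).bddAbove m)
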